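/- Let $\mathcal K$ be a field, $T$ the set of monomials of $\mathcal K[x_1,\dots,x_n]$ with an admissible order $<$, and $f_1,\dots,f_m$ ($m\ge 1$) nonzero homogeneous polynomials. Write $\mathrm{HM}(p)\in T$ for the head monomial of $p$. A signature is $t\mathbf F_i$ with $t\in T$, $1\le i\le m$ (its index); $t\mathbf F_i\prec t'\mathbf F_{i'}$ iff $i>i'$, or $i=i'$ and $t<t'$; $t\mathbf F_i$ divides $t'\mathbf F_{i'}$ iff $i=i'$ and $t\mid t'$. A labeled polynomial is a pair $r=(\mathcal S(r),\mathrm{poly}(r))$ of a signature and a polynomial. Consider an execution (finite or infinite) of Faugère's original F5 algorithm on $f_1,\dots,f_m$. It keeps an array $r_1,\dots,r_N$ of labeled polynomials, initially $N=m$ and $r_i=(\mathbf F_i,f_i/\mathrm{HC}(f_i))$ with $\mathrm{HC}$ the head coefficient, and lists $Rule[i]$ of rules $(t,k)$, initially empty. $\texttt{Rewritten?}(u,r_k)$, where $\mathcal S(r_k)=v\mathbf F_i$, is true iff some rule $(t,l)$ in $Rule[i]$ has $t\mid uv$ and the most recently added such rule has $l\ne k$. Whenever an S-polynomial with higher part $u\,r_a$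 and lower part $v\,r_b$ is generated, $N$ is increased by $1$, $r_N=(u\,\mathcal S(r_a),\,u\,\mathrm{poly}(r_a)-v\,\mathrm{poly}(r_b))$ (both polynomials made monic), the rule for $\mathcal S(r_N)$ is added, and one writes $N^*=a$. Start with $G_m=\{r_m\}$. For $i=m-1,\dots,1$: let $\varphi$ be the normal form operator modulo $\mathrm{poly}(G_{i+1})$, put $G_i=G_{i+1}\cup\{r_i\}$ and $P=\{\mathrm{CritPair}(r_i,r): r\in G_{i+1}\}$. While $P\neq\emptyset$: remove from $P$ all pairs of least degree; apply $\texttt{Spol}$ to them, giving a set $F$; apply $\texttt{Reduction}$ to $F$, giving $R_d$; for each $r\in R_d$ in turn, add to $P$ the pairs $\mathrm{CritPair}(r,p)$, $p\in G_i$, and then add $r$ to $G_i$. If afterwards $G_i$ contains a labeled polynomial whose polynomial is $1$, stop. Here: - $\mathrm{CritPair}(r,r')=[t,u_1,r_{k_1},u_2,r_{k_2}]$, where $\{r_{k_1},r_{k_2}\}=\{r,r'\}$, $t$ (whose degree is the degree of the pair) is the least common multiple of their head monomials, $u_j=t/\mathrm{HM}(r_{k_j})$, and $u_1\mathcal S(r_{k_1})\not\prec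 u_2\mathcal S(r_{k_2})$. With $\mathcal S(r_{k_j})=t_j\mathbf F_{i_j}$, the pair is discarded if $i_1>i$, or $\varphi(u_1t_1)\ne u_1t_1$, or $i_2=i$ and $\varphi(u_2t_2)\neq u_2t_2$. - $\texttt{Spol}$ treats its pairs one after another and generates the S-polynomial with higher part $u_1r_{k_1}$ and lower part $u_2r_{k_2}$ iff neither $\texttt{Rewritten?}(u_1,r_{k_1})$ nor $\texttt{Rewritten?}(u_2,r_{k_2})$; $F$ is the set of these. - $\texttt{Reduction}$ starts with $ToDo=F$, $Done=\emptyset$. While $ToDo\ne\emptyset$, it takes $h\in ToDo$ of least signature, replaces $\mathrm{poly}(h)$ by $\varphi(\mathrm{poly}(h))$, and drops $h$ from $ToDo$ if this is $0$. Otherwise it looks for a reductor $r_j\in G_i\cup Done$, $\mathcal S(r_j)=t_j\mathbf F_{i_j}$, such that (a) $u=\mathrm{HM}(h)/\mathrm{HM}(r_j)\in T$, (b) $\varphi(ut_j)=ut_j$, (c) not $\texttt{Rewritten?}(u,r_j)$, (d) $u\mathcal S(r_j)\ne\mathcal S(h)$. If there is none, $h$ is made monic and moved to $Done$. If one is chosen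 and $u\mathcal S(r_j)\prec\mathcal S(h)$, the head term of $\mathrm{poly}(h)$ is cancelled by subtracting a multiple of $u\,\mathrm{poly}(r_j)$. If $u\mathcal S(r_j)\succ\mathcal S(h)$, the S-polynomial with higher part $u\,r_j$ and lower part $1\cdot h$ is generated and added to $ToDo$. When $ToDo=\emptyset$, $Done$ is returned. Choices left open here (order of traversal, choice among several reductors) are arbitrary. An S-pair-chain is a sequence of generated labeled polynomials in which every two successive elements $r_a,r_b$ satisfy $a=b^*$ and $\mathcal S(r_a)\mid\mathcal S(r_b)$. **Theorem.** For every labeled polynomial $r_L$ occurring in the execution (the input ones $r_1,\dots,r_m$ included), there are only finitely many $l$ with $l^*=L$, that is, $r_L$ is the higher S-pair part of only finitely many S-polynomials generated. In particular, $r_L$ is the first element of only finitely many S-pair-chains of length $2$. -/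

import Mathlib

/-! # The F5 algorithm as a transition system

Monomials in `n` variables are exponent vectors `Fin n →₀ ℕ`: the product of monomials is `+`,
divisibility is the pointwise order `≤`, the least common multiple is `⊔` and, for `t ≤ s`, the
quotient `s / t` is `s - t`. Input polynomials and signature indices are numbered `0, …, m - 1`
(instead of `1, …, m`). -/

namespace F5

open MvPolynomial

noncomputable section

/-- The signature `mon · 𝐅_idx`. -/
structure Signature (n : ℕ) where
  mon : Fin n →₀ ℕ
  idx : ℕ

/-- The product `u · s` of a monomial and a signature. -/
def Signature.smul {n : ℕ} (u : Fin n →₀ ℕ) (s : Signature n) : Signature n :=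
  ⟨u + s.mon, s.idx⟩

/-- Divisibility of signatures. -/
def Signature.Dvd {n : ℕ} (s s' : Signature n) : Prop :=
  ∃ u : Fin n →₀ ℕ, s' = s.smul u

/-- The order `s ≺ s'` on signatures: `𝐅_0 ≻ 𝐅_1 ≻ ⋯`, and for equal indices the given
monomial order decides. -/
def Signature.Lt {n : ℕ} (ord : MonomialOrder (Fin n)) (s s' : Signature n) : Prop :=
  s'.idx < s.idx ∨ (s.idx = s'.idx ∧ ord.toSyn s.mon < ord.toSyn s'.mon)

/-- A labeled polynomial `r = (S(r), poly(r))`. -/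
structure LabeledPoly (n : ℕ) (K : Type*) [Field K] where
  sig : Signature n
  poly : MvPolynomial (Fin n) K

/-- A critical pair `[t, u₁, r₁, u₂, r₂]`; `r_hi` is the part with the greater signature.
Labeled polynomials are referred to by their position in the array `R`. -/
structure CritPair (n : ℕ) where
  t : Fin n →₀ ℕ
  uhi : Fin n →₀ ℕ
  hi : ℕ
  ulo : Fin n →₀ ℕ
  lo : ℕ

/-- The point that the execution has reached, with the local variables of the procedure. -/
inductive Phase (n : ℕ) where
  /-- head of the outer loop `for i = m - 2 downto 0` of `incrementalF5` -/
  | next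
  /-- head of the `while P ≠ ∅` loop of `AlgorithmF5` -/
  | loop
  /-- in `Spol`: critical pairs `B` still to be treated, S-polynomials `F` computed so far -/
  | spol (B : Finset (CritPair n)) (F : Finset ℕ)
  /-- head of the `while ToDo ≠ ∅` loop of `Reduction` -/
  | reduction (ToDo Done : Finset ℕ)
  /-- in the loop `for r ∈ R_d` of `AlgorithmF5`: elements still to be treated -/
  | update (Rd : Finset ℕ)
  /-- the algorithm has returned -/
  | halt

/-- Memory of the algorithm. Exactly the cells `R k`, `k < N`, of the array `R` are in use. -/
structure State (n : ℕ) (K : Type*) [Field K] where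
  N : ℕ
  R : ℕ → LabeledPoly n K
  /-- `rules i` is the list `Rule[i]`, newest rule first; `(t, k)` is the rule for
  `S(r_k) = t 𝐅_i`. -/
  rules : ℕ → List ((Fin n →₀ ℕ) × ℕ)
  /-- Record kept for the analysis only: `origin l = some (l^*, l_*)` if `r_l` was created as the
  S-polynomial with greater-signature part `r_{l^*}` and smaller-signature part `r_{l_*}`;
  `none` if `r_l` is an input polynomial. -/
  origin : ℕ → Option (ℕ × ℕ)
  /-- index of the current call of `AlgorithmF5` -/
  i : ℕ
  /-- the set `G_{i+1}` -/
  Gprev : Finset ℕ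
  /-- the set `G_i` -/
  G : Finset ℕ
  /-- the set of critical pairs -/
  P : Finset (CritPair n)
  phase : Phase n

section
variable {n m : ℕ} {K : Type*} [Field K] (ord : MonomialOrder (Fin n))

/-- `HC(p)⁻¹ p` -/
def monic (p : MvPolynomial (Fin n) K) : MvPolynomial (Fin n) K :=
  C (ord.leadingCoeff p)⁻¹ * p

/-- One step of polynomial reduction modulo `B`, at an arbitrary term. -/
def ReducesTo (B : Set (MvPolynomial (Fin n) K)) (p q : MvPolynomial (Fin n) K) : Prop :=
  ∃ g ∈ B, g ≠ 0 ∧ ∃ a ∈ p.support, ord.degree g ≤ a ∧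
    q = p - monomial (a - ord.degree g) (p.coeff a / ord.leadingCoeff g) * g

/-- `q` is a normal form of `p` modulo `B` (the normal form if `B` is a Gröbner basis). -/
def IsNormalForm (B : Set (MvPolynomial (Fin n) K)) (p q : MvPolynomial (Fin n) K) : Prop :=
  Relation.ReflTransGen (ReducesTo ord B) p q ∧ ∀ q', ¬ ReducesTo ord B q q'

namespace State
variable (st : State n K)

/-- head monomial of `r_k` -/
def hm (k : ℕ) : Fin n →₀ ℕ := ord.degree (st.R k).poly

/-- signature of `r_k` -/
def sig (k : ℕ) : Signature n := (st.R k).sig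

/-- The graph `q = φ_{i+1}(p)` of the normal form operator modulo `G_{i+1}`. -/
def Phi (p q : MvPolynomial (Fin n) K) : Prop :=
  IsNormalForm ord {g | ∃ k ∈ st.Gprev, g = (st.R k).poly} p q

/-- `φ_{i+1}(t) = t` for a monomial `t` -/
def PhiFixes (t : Fin n →₀ ℕ) : Prop :=
  st.Phi ord (monomial t 1) (monomial t 1)

open Classical in
/-- The position `l` of the labeled polynomial returned by `Rewriting(u, r_k)`: the one of the
newest rule whose signature divides `u S(r_k)`, and `k` itself if there is no such rule. -/
def rewriting (u : Fin n →₀ ℕ) (k : ℕ) : ℕ :=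
  match (st.rules (st.sig k).idx).find? (fun r => decide (r.1 ≤ u + (st.sig k).mon)) with
  | some r => r.2
  | none => k

/-- `Rewritten?(u, r_k)` -/
def Rewritten (u : Fin n →₀ ℕ) (k : ℕ) : Prop := st.rewriting u k ≠ k

open Classical in
/-- `CritPair(r_a, r_b, i, φ_{i+1})`; `none` if the pair is discarded. -/
def critPair (a b : ℕ) : Option (CritPair n) :=
  let t := st.hm ord a ⊔ st.hm ord b
  let ua := t - st.hm ord a
  let ub := t - st.hm ord b
  let p : CritPair n :=
    if ((st.sig a).smul ua).Lt ord ((st.sig b).smul ub) then ⟨t, ub, b, ua, a⟩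
    else ⟨t, ua, a, ub, b⟩
  if st.i < (st.sig p.hi).idx then none
  else if ¬ st.PhiFixes ord (p.uhi + (st.sig p.hi).mon) then none
  else if (st.sig p.lo).idx = st.i ∧ ¬ st.PhiFixes ord (p.ulo + (st.sig p.lo).mon) then none
  else some p

open Classical in
/-- `{CritPair(r_a, r_b, i, φ_{i+1}) | r_b ∈ H}` -/
def critPairs (a : ℕ) (H : Finset ℕ) : Finset (CritPair n) :=
  H.biUnion fun b => (st.critPair ord a b).toFinset

/-- Replace `poly(r_k)`; the signature is kept. -/
def setPoly (k : ℕ) (p : MvPolynomial (Fin n) K) : State n K :=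
  { st with R := Function.update st.R k ⟨(st.R k).sig, p⟩ }

/-- Append `r_N = (u S(r_hi), u poly(r_hi) - v poly(r_lo))`, the two polynomials being made monic,
to `R`, and add the rule for it. -/
def addSPoly (u : Fin n →₀ ℕ) (hi : ℕ) (v : Fin n →₀ ℕ) (lo : ℕ) : State n K :=
  { st with
    N := st.N + 1
    R := Function.update st.R st.N
      ⟨(st.sig hi).smul u,
        monomial u 1 * monic ord (st.R hi).poly - monomial v 1 * monic ord (st.R lo).poly⟩
    rules := Function.update st.rules (st.sig hi).idx
      ((u + (st.sig hi).mon, st.N) :: st.rules (st.sig hi).idx)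
    origin := Function.update st.origin st.N (some (hi, lo)) }

/-- `r_k`, `k ∈ H`, may be returned by `IsReducible(r_h, H, i, φ_{i+1})`:
the four conditions (a) – (d), with `u = HM(r_h) / HM(r_k)`. -/
def IsReductor (H : Finset ℕ) (h k : ℕ) : Prop :=
  k ∈ H ∧ st.hm ord k ≤ st.hm ord h ∧
    st.PhiFixes ord ((st.hm ord h - st.hm ord k) + (st.sig k).mon) ∧
    ¬ st.Rewritten (st.hm ord h - st.hm ord k) k ∧
    (st.sig k).smul (st.hm ord h - st.hm ord k) ≠ st.sig h

end State

/-- The state in which the outer loop is entered: `R = (r_0, …, r_{m-1})` holds the input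
polynomials made monic, all lists of rules are empty and `G_{m-1} = {r_{m-1}}`. -/
def initial (f : Fin m → MvPolynomial (Fin n) K) : State n K where
  N := m
  R k := if h : k < m then ⟨⟨0, k⟩, monic ord (f ⟨k, h⟩)⟩ else ⟨⟨0, 0⟩, 0⟩
  rules _ := []
  origin _ := none
  i := m - 1
  Gprev := ∅
  G := {m - 1}
  P := ∅
  phase := .next

open Classical in
/-- One step of the execution. Choices that the algorithm leaves open (order in which sets are
traversed, choice among several admissible reductors) are nondeterministic. -/
inductive Step : State n K → State n K → Prop
  /-- end of the outer loop -/
  | finish (st : State n K) (h : st.phase = .next) (hi : st.i = 0) :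
      Step st { st with phase := .halt }
  /-- call of `AlgorithmF5` for the next smaller index `j` -/
  | call (st : State n K) (h : st.phase = .next) (j : ℕ) (hj : st.i = j + 1)
      (st' : State n K)
      (hst' : st' = { st with i := j, Gprev := st.G, G := insert j st.G, P := ∅ }) :
      Step st { st' with P := st'.critPairs ord j st.G, phase := .loop }
  /-- `P = ∅`: `AlgorithmF5` returns, and some polynomial is `1` -/
  | one (st : State n K) (h : st.phase = .loop) (hP : st.P = ∅)
      (h1 : ∃ k ∈ st.G, (st.R k).poly = 1) :
      Step st { st with phase := .halt }
  /-- `P = ∅`: `AlgorithmF5` returns, and no polynomial is `1` -/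
  | ret (st : State n K) (h : st.phase = .loop) (hP : st.P = ∅)
      (h1 : ¬ ∃ k ∈ st.G, (st.R k).poly = 1) :
      Step st { st with phase := .next }
  /-- extract all critical pairs of the least degree `d` from `P` and pass them to `Spol` -/
  | select (st : State n K) (h : st.phase = .loop) (d : ℕ)
      (hd : ∃ p ∈ st.P, p.t.degree = d) (hmin : ∀ p ∈ st.P, d ≤ p.t.degree) :
      Step st { st with
        P := st.P.filter (fun p => p.t.degree ≠ d)
        phase := .spol (st.P.filter (fun p => p.t.degree = d)) ∅ }
  /-- `Spol`: one part of the pair is rewritten, the pair is rejected -/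
  | spolReject (st : State n K) (B : Finset (CritPair n)) (F : Finset ℕ)
      (h : st.phase = .spol B F) (p : CritPair n) (hp : p ∈ B)
      (hr : st.Rewritten p.uhi p.hi ∨ st.Rewritten p.ulo p.lo) :
      Step st { st with phase := .spol (B.erase p) F }
  /-- `Spol`: the S-polynomial of the pair is computed -/
  | spolAccept (st : State n K) (B : Finset (CritPair n)) (F : Finset ℕ)
      (h : st.phase = .spol B F) (p : CritPair n) (hp : p ∈ B)
      (hhi : ¬ st.Rewritten p.uhi p.hi) (hlo : ¬ st.Rewritten p.ulo p.lo) :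
      Step st { st.addSPoly ord p.uhi p.hi p.ulo p.lo with
        phase := .spol (B.erase p) (insert st.N F) }
  /-- `Spol` returns `F`, and `Reduction` starts -/
  | spolRet (st : State n K) (F : Finset ℕ) (h : st.phase = .spol ∅ F) :
      Step st { st with phase := .reduction F ∅ }
  /-- `TopReduction(φ(r_h))` for an `r_h ∈ ToDo` of least signature: `φ(r_h)` is zero -/
  | redZero (st : State n K) (T D : Finset ℕ) (h : st.phase = .reduction T D)
      (k : ℕ) (hk : k ∈ T) (hmin : ∀ k' ∈ T, ¬ (st.sig k').Lt ord (st.sig k))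
      (hq : st.Phi ord (st.R k).poly 0) :
      Step st { st.setPoly k 0 with phase := .reduction (T.erase k) D }
  /-- `TopReduction`: no reductor, the polynomial is made monic and moved to `Done` -/
  | redDone (st : State n K) (T D : Finset ℕ) (h : st.phase = .reduction T D)
      (k : ℕ) (hk : k ∈ T) (hmin : ∀ k' ∈ T, ¬ (st.sig k').Lt ord (st.sig k))
      (q : MvPolynomial (Fin n) K) (hq : st.Phi ord (st.R k).poly q) (hq0 : q ≠ 0)
      (hno : ∀ j, ¬ (st.setPoly k q).IsReductor ord (st.G ∪ D) k j) :
      Step st { st.setPoly k (monic ord q) with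
        phase := .reduction (T.erase k) (insert k D) }
  /-- `TopReduction`: the multiplied reductor has the smaller signature, the reduction is carried out -/
  | redSafe (st : State n K) (T D : Finset ℕ) (h : st.phase = .reduction T D)
      (k : ℕ) (hk : k ∈ T) (hmin : ∀ k' ∈ T, ¬ (st.sig k').Lt ord (st.sig k))
      (q : MvPolynomial (Fin n) K) (hq : st.Phi ord (st.R k).poly q) (hq0 : q ≠ 0)
      (j : ℕ) (hj : (st.setPoly k q).IsReductor ord (st.G ∪ D) k j)
      (u : Fin n →₀ ℕ) (hu : u = (st.setPoly k q).hm ord k - (st.setPoly k q).hm ord j)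
      (hs : ((st.sig j).smul u).Lt ord (st.sig k)) :
      Step st { st.setPoly k
          (q - monomial u (ord.leadingCoeff q / ord.leadingCoeff (st.R j).poly) * (st.R j).poly)
        with phase := .reduction T D }
  /-- `TopReduction`: the multiplied reductor has the greater signature, the S-polynomial is computed and
  added to `ToDo` -/
  | redUnsafe (st : State n K) (T D : Finset ℕ) (h : st.phase = .reduction T D)
      (k : ℕ) (hk : k ∈ T) (hmin : ∀ k' ∈ T, ¬ (st.sig k').Lt ord (st.sig k))
      (q : MvPolynomial (Fin n) K) (hq : st.Phi ord (st.R k).poly q) (hq0 : q ≠ 0)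
      (j : ℕ) (hj : (st.setPoly k q).IsReductor ord (st.G ∪ D) k j)
      (u : Fin n →₀ ℕ) (hu : u = (st.setPoly k q).hm ord k - (st.setPoly k q).hm ord j)
      (hs : ¬ ((st.sig j).smul u).Lt ord (st.sig k)) :
      Step st { (st.setPoly k q).addSPoly ord u j 0 k with
        phase := .reduction (insert st.N T) D }
  /-- `Reduction` returns `Done` -/
  | redRet (st : State n K) (D : Finset ℕ) (h : st.phase = .reduction ∅ D) :
      Step st { st with phase := .update D }
  /-- the new critical pairs with `r_k ∈ R_d` are formed, and `r_k` is added to `G_i` -/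
  | insertNew (st : State n K) (D : Finset ℕ) (h : st.phase = .update D) (k : ℕ) (hk : k ∈ D) :
      Step st { st with
        P := st.P ∪ st.critPairs ord k st.G
        G := insert k st.G
        phase := .update (D.erase k) }
  /-- end of the loop over `R_d` -/
  | updateRet (st : State n K) (h : st.phase = .update ∅) :
      Step st { st with phase := .loop }

/-- `run` is a complete execution on the input `f`: it goes on forever, or it reaches a state
without successor and then stays there. -/
def IsRun (f : Fin m → MvPolynomial (Fin n) K) (run : ℕ → State n K) : Prop :=
  run 0 = initial ord f ∧
    ∀ τ, Step ord (run τ) (run (τ + 1)) ∨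
      ((∀ st, ¬ Step ord (run τ) st) ∧ run (τ + 1) = run τ)

end

section
variable {n : ℕ} {K : Type*} [Field K]

/-- `r_k` is one of the labeled polynomials generated (or given) during the execution. -/
def Generated (run : ℕ → State n K) (k : ℕ) : Prop :=
  ∃ τ, k < (run τ).N

/-- `a = b^*`: the labeled polynomial `r_b` was generated as an S-polynomial of which `r_a` is
the part with the greater signature. -/
def IsHigherPart (run : ℕ → State n K) (a b : ℕ) : Prop :=
  ∃ τ c, (run τ).origin b = some (a, c)

/-- A finite S-pair-chain, given by the positions of its elements in `R`: every element is the
higher S-pair part of the next one, and its signature divides that of the next one. -/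
def IsSPairChain (run : ℕ → State n K) (c : List ℕ) : Prop :=
  (∀ k ∈ c, Generated run k) ∧
    c.IsChain fun a b => IsHigherPart run a b ∧
      ∃ τ, a < (run τ).N ∧ b < (run τ).N ∧ ((run τ).sig a).Dvd ((run τ).sig b)

end

end

end F5

namespace F5

open MvPolynomial

variable {n m : ℕ} {K : Type*} [Field K] {ord : MonomialOrder (Fin n)}

/-! An S-polynomial with higher part `u · r_L` is generated only if `u · r_L` is not rewritten at
that moment. Let `r_l` be an earlier S-polynomial with the same higher part. Its rule is in the list
of the common index and is newer than `r_L`. If `S(r_l)` divided `u S(r_L)`, the newest applicable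
rule would belong to a position at least `l > L`, and `u · r_L` would be rewritten. Hence, in order
of generation, the signatures of the S-polynomials with higher part `r_L` have one index, and no
earlier monomial divides a later one. By Dickson's lemma such a sequence of monomials is finite.

The non-divisibility is the invariant `RuleInvariant.not_le`. It is preserved because of
`State.rewritten_of_mem_rules`, and `IsRun.finite_isHigherPart` draws the conclusion. `RefsBelow`
ensures that a higher part is always older than the S-polynomial built from it. -/

/-- Invariants relating signatures, rules and origins. -/
structure RuleInvariant (st : State n K) : Prop where
  sorted : ∀ i, (st.rules i).Pairwise fun r s => s.2 < r.2
  rule_lt : ∀ i, ∀ r ∈ st.rules i, r.2 < st.N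
  origin_lt : ∀ {l a c}, st.origin l = some (a, c) → a < l ∧ l < st.N
  origin_idx : ∀ {l a c}, st.origin l = some (a, c) → (st.sig l).idx = (st.sig a).idx
  origin_rule : ∀ {l a c}, st.origin l = some (a, c) →
    ((st.sig l).mon, l) ∈ st.rules (st.sig l).idx
  not_le : ∀ {l l' a c c'}, st.origin l = some (a, c) → st.origin l' = some (a, c') → l < l' →
    ¬ (st.sig l).mon ≤ (st.sig l').mon

/-- The references stored in the phase point to cells of `R` in use. -/
def Phase.RefsBelow (N : ℕ) : Phase n → Prop
  | .spol B F => (∀ p ∈ B, p.hi < N) ∧ ∀ k ∈ F, k < N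
  | .reduction T D => (∀ k ∈ T, k < N) ∧ ∀ k ∈ D, k < N
  | .update D => ∀ k ∈ D, k < N
  | _ => True

/-- All references stored in the state point to cells of `R` in use. -/
structure RefsBelow (st : State n K) : Prop where
  i_lt : st.i < st.N
  G_lt : ∀ k ∈ st.G, k < st.N
  P_lt : ∀ p ∈ st.P, p.hi < st.N
  phase_lt : st.phase.RefsBelow st.N

/-! ### Signatures under updates, and the parts of critical pairs -/

theorem State.sig_setPoly (st : State n K) (k : ℕ) (p : MvPolynomial (Fin n) K) (l : ℕ) :
    (st.setPoly k p).sig l = st.sig l := by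
  unfold State.sig State.setPoly
  by_cases h : l = k
  · subst h; simp
  · simp [h]

theorem State.sig_addSPoly_of_ne (st : State n K) (u : Fin n →₀ ℕ) (hi : ℕ) (v : Fin n →₀ ℕ)
    (lo : ℕ) {l : ℕ} (hl : l ≠ st.N) : (st.addSPoly ord u hi v lo).sig l = st.sig l := by
  simp [State.sig, State.addSPoly, hl]

theorem State.sig_addSPoly_self (st : State n K) (u : Fin n →₀ ℕ) (hi : ℕ) (v : Fin n →₀ ℕ)
    (lo : ℕ) : (st.addSPoly ord u hi v lo).sig st.N = (st.sig hi).smul u := by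
  simp [State.sig, State.addSPoly]

theorem State.hi_of_critPair_eq_some {st : State n K} {a b : ℕ} {p : CritPair n}
    (h : st.critPair ord a b = some p) : p.hi = a ∨ p.hi = b := by
  classical
  -- The conditional choosing the higher part is treated here, apart from the discarding tests.
  -- Below, `clear_value` hides it, so that `split_ifs` sees only those tests.
  have aux : ∀ (c : Prop) [Decidable c] (p q : CritPair n), (if c then p else q).hi = p.hi ∨
      (if c then p else q).hi = q.hi := by
    intro c _ p q
    split_ifs <;> simp
  unfold State.critPair at h
  extract_lets t ua ub p' at h
  have hp : p' = p := by
    clear_value p'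
    split_ifs at h
    exact Option.some.inj h
  rw [← hp]
  exact (aux _ _ _).symm

theorem State.hi_lt_of_mem_critPairs {st : State n K} {a N : ℕ} {H : Finset ℕ} {p : CritPair n}
    (ha : a < N) (hH : ∀ k ∈ H, k < N) (hp : p ∈ st.critPairs ord a H) : p.hi < N := by
  simp only [State.critPairs, Finset.mem_biUnion, Option.mem_toFinset, Option.mem_def] at hp
  obtain ⟨b, hb, h⟩ := hp
  rcases State.hi_of_critPair_eq_some h with h | h <;> rw [h]
  exacts [ha, hH b hb]

/-! ### The rewriting criterion -/

/-- A product `u S(r_k)` divisible by the signature of a rule added after `r_k` is rewritten. -/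
theorem State.rewritten_of_mem_rules {st : State n K}
    (hs : ∀ i, (st.rules i).Pairwise fun r s => s.2 < r.2) {u t : Fin n →₀ ℕ} {k l : ℕ}
    (hmem : (t, l) ∈ st.rules (st.sig k).idx) (hle : t ≤ u + (st.sig k).mon) (hkl : k < l) :
    st.Rewritten u k := by
  classical
  -- The first rule that applies stands no later in the list than `(t, l)`, and positions decrease
  -- along the list, so its position is at least `l`.
  have key : ∀ rs : List ((Fin n →₀ ℕ) × ℕ), rs.Pairwise (fun r s => s.2 < r.2) → (t, l) ∈ rs →
      ∃ r, rs.find? (fun r => decide (r.1 ≤ u + (st.sig k).mon)) = some r ∧ l ≤ r.2 := by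
    intro rs
    induction rs with
    | nil => simp
    | cons r rs ih =>
      intro hp hm
      rw [List.pairwise_cons] at hp
      by_cases hr : r.1 ≤ u + (st.sig k).mon
      · refine ⟨r, by simp [hr], ?_⟩
        rcases List.mem_cons.1 hm with rfl | hm
        exacts [le_rfl, (hp.1 _ hm).le]
      · rcases List.mem_cons.1 hm with rfl | hm
        · exact absurd hle hr
        · obtain ⟨s, h, hl⟩ := ih hp.2 hm
          exact ⟨s, by simpa [hr] using h, hl⟩
  obtain ⟨r, hr, hl⟩ := key _ (hs _) hmem
  have : st.rewriting u k = r.2 := by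
    unfold State.rewriting
    convert_to (match some r with | some r => r.2 | none => k) = r.2
    · rw [← hr]
    · rfl
  unfold State.Rewritten
  omega

/-! ### Preservation of the invariants -/

/-- The invariant does not see polynomials, pairs, basis sets or phases, so this settles every step
that generates no S-polynomial. -/
theorem RuleInvariant.congr {st st' : State n K} (h : RuleInvariant st) (hN : st'.N = st.N)
    (hsig : ∀ k, st'.sig k = st.sig k) (hr : st'.rules = st.rules)
    (ho : st'.origin = st.origin) : RuleInvariant st' := by
  constructor <;> simp only [hN, hsig, hr, ho]
  exacts [h.sorted, h.rule_lt, h.origin_lt, h.origin_idx, h.origin_rule, h.not_le]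

theorem RuleInvariant.setPoly {st : State n K} (h : RuleInvariant st) (k : ℕ)
    (p : MvPolynomial (Fin n) K) : RuleInvariant (st.setPoly k p) :=
  h.congr rfl (st.sig_setPoly k p) rfl rfl

/-- The new rule goes to the head of its list with the largest position so far, which keeps the list
sorted. For `not_le`, the only new case is an old `l` against the new position `st.N`; divisibility
there would contradict `hu`. -/
theorem RuleInvariant.addSPoly {st : State n K} (h : RuleInvariant st) {u : Fin n →₀ ℕ} {hi : ℕ}
    (v : Fin n →₀ ℕ) (lo : ℕ) (hhi : hi < st.N) (hu : ¬ st.Rewritten u hi) :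
    RuleInvariant (st.addSPoly ord u hi v lo) := by
  have hself := st.sig_addSPoly_self (ord := ord) u hi v lo
  have hsig : ∀ {l}, l < st.N → (st.addSPoly ord u hi v lo).sig l = st.sig l :=
    fun hl => st.sig_addSPoly_of_ne u hi v lo hl.ne
  have hrules : ∀ i, (st.addSPoly ord u hi v lo).rules i = if i = (st.sig hi).idx then
      (u + (st.sig hi).mon, st.N) :: st.rules i else st.rules i := by
    intro i
    by_cases hi' : i = (st.sig hi).idx
    · subst hi'; simp [State.addSPoly]
    · simp [State.addSPoly, hi']
  have horigin : ∀ {l a c}, (st.addSPoly ord u hi v lo).origin l = some (a, c) →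
      (l = st.N ∧ a = hi) ∨ st.origin l = some (a, c) := by
    intro l a c hl
    by_cases hlN : l = st.N
    · subst hlN
      simp only [State.addSPoly, Function.update_self, Option.some.injEq, Prod.mk.injEq] at hl
      exact .inl ⟨rfl, hl.1.symm⟩
    · exact .inr (by simpa [State.addSPoly, hlN] using hl)
  have hN : (st.addSPoly ord u hi v lo).N = st.N + 1 := rfl
  refine ⟨fun i => ?_, fun i r hr => ?_, fun {l a c} hl => ?_, fun {l a c} hl => ?_,
    fun {l a c} hl => ?_, fun {l l' a c c'} hl hl' hlt => ?_⟩
  · rw [hrules]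
    split_ifs
    · exact List.pairwise_cons.2 ⟨h.rule_lt i, h.sorted i⟩
    · exact h.sorted i
  · rw [hN]
    rw [hrules] at hr
    split_ifs at hr
    · rcases List.mem_cons.1 hr with rfl | hr
      · exact Nat.lt_succ_self _
      · exact (h.rule_lt i r hr).trans (Nat.lt_succ_self _)
    · exact (h.rule_lt i r hr).trans (Nat.lt_succ_self _)
  · rw [hN]
    rcases horigin hl with ⟨rfl, rfl⟩ | hl
    · exact ⟨hhi, Nat.lt_succ_self _⟩
    · have := h.origin_lt hl
      omega
  · rcases horigin hl with ⟨rfl, rfl⟩ | hl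
    · rw [hself, hsig hhi]; rfl
    · have := h.origin_lt hl
      rw [hsig this.2, hsig (this.1.trans this.2), h.origin_idx hl]
  · rcases horigin hl with ⟨rfl, rfl⟩ | hl
    · rw [hself, hrules]
      simp [Signature.smul]
    · rw [hsig (h.origin_lt hl).2, hrules]
      split_ifs
      · exact List.mem_cons_of_mem _ (h.origin_rule hl)
      · exact h.origin_rule hl
  · rcases horigin hl with ⟨rfl, rfl⟩ | h₁
    · rcases horigin hl' with ⟨rfl, -⟩ | h₂
      · exact absurd hlt (lt_irrefl _)
      · exact absurd hlt (h.origin_lt h₂).2.not_gt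
    · rw [hsig (h.origin_lt h₁).2]
      rcases horigin hl' with ⟨rfl, rfl⟩ | h₂
      · rw [hself]
        intro hle
        -- The rule of `l` lies in the list consulted for the higher part because an S-polynomial
        -- inherits the index of its higher part.
        refine hu (State.rewritten_of_mem_rules h.sorted ?_ hle (h.origin_lt h₁).1)
        rw [← h.origin_idx h₁]
        exact h.origin_rule h₁
      · rw [hsig (h.origin_lt h₂).2]
        exact h.not_le h₁ h₂ hlt

theorem ruleInvariant_initial (f : Fin m → MvPolynomial (Fin n) K) :
    RuleInvariant (initial ord f) := by
  constructor <;> simp [initial]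

theorem refsBelow_initial (hm : 0 < m) (f : Fin m → MvPolynomial (Fin n) K) :
    RefsBelow (initial ord f) := by
  constructor <;> simp [initial, Phase.RefsBelow, hm]

/-- Higher parts are read from stored pairs, from `G` or from `Done`, possibly long after being
stored. All these references must therefore be bounded together; since `N` never decreases, old
bounds survive. -/
theorem Step.refsBelow {st st' : State n K} (hstep : Step ord st st') (hr : RefsBelow st) :
    RefsBelow st' := by
  classical
  obtain ⟨hi, hG, hP, hph⟩ := hr
  cases hstep with
  | finish h hi0 => exact ⟨hi, hG, hP, trivial⟩
  | call h j hj st'' hst' =>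
    subst hst'
    have hj' : j < st.N := by omega
    refine ⟨hj', ?_, fun p hp => State.hi_lt_of_mem_critPairs hj' hG hp, trivial⟩
    intro k hk
    rcases Finset.mem_insert.1 hk with rfl | hk
    exacts [hj', hG k hk]
  | one h _ _ => exact ⟨hi, hG, hP, trivial⟩
  | ret h _ _ => exact ⟨hi, hG, hP, trivial⟩
  | select h d hd hmin =>
    exact ⟨hi, hG, fun p hp => hP p (Finset.mem_filter.1 hp).1,
      fun p hp => hP p (Finset.mem_filter.1 hp).1, by simp⟩
  | spolReject B F h p hp _ =>
    rw [h] at hph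
    exact ⟨hi, hG, hP, fun q hq => hph.1 q (Finset.mem_of_mem_erase hq), hph.2⟩
  | spolAccept B F h p hp _ _ =>
    rw [h] at hph
    refine ⟨Nat.lt_succ_of_lt hi, fun k hk => Nat.lt_succ_of_lt (hG k hk),
      fun k hk => Nat.lt_succ_of_lt (hP k hk),
      fun q hq => Nat.lt_succ_of_lt (hph.1 q (Finset.mem_of_mem_erase hq)), fun k hk => ?_⟩
    rcases Finset.mem_insert.1 hk with rfl | hk
    exacts [Nat.lt_succ_self _, Nat.lt_succ_of_lt (hph.2 k hk)]
  | spolRet F h =>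
    rw [h] at hph
    exact ⟨hi, hG, hP, hph.2, by simp⟩
  | redZero T D h k hk _ _ =>
    rw [h] at hph
    exact ⟨hi, hG, hP, fun l hl => hph.1 l (Finset.mem_of_mem_erase hl), hph.2⟩
  | redDone T D h k hk _ q _ _ _ =>
    rw [h] at hph
    refine ⟨hi, hG, hP, fun l hl => hph.1 l (Finset.mem_of_mem_erase hl), fun l hl => ?_⟩
    rcases Finset.mem_insert.1 hl with rfl | hl
    exacts [hph.1 _ hk, hph.2 l hl]
  | redSafe T D h k hk _ q _ _ j _ u _ _ =>
    rw [h] at hph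
    exact ⟨hi, hG, hP, hph⟩
  | redUnsafe T D h k hk _ q _ _ j _ u _ _ =>
    rw [h] at hph
    refine ⟨Nat.lt_succ_of_lt hi, fun k hk => Nat.lt_succ_of_lt (hG k hk),
      fun k hk => Nat.lt_succ_of_lt (hP k hk), fun l hl => ?_,
      fun l hl => Nat.lt_succ_of_lt (hph.2 l hl)⟩
    rcases Finset.mem_insert.1 hl with rfl | hl
    exacts [Nat.lt_succ_self _, Nat.lt_succ_of_lt (hph.1 l hl)]
  | redRet D h =>
    rw [h] at hph
    exact ⟨hi, hG, hP, hph.2⟩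
  | insertNew D h k hk =>
    rw [h] at hph
    have hk' : k < st.N := hph k hk
    refine ⟨hi, fun l hl => ?_, fun p hp => ?_, fun l hl => hph l (Finset.mem_of_mem_erase hl)⟩
    · rcases Finset.mem_insert.1 hl with rfl | hl
      exacts [hk', hG l hl]
    · rcases Finset.mem_union.1 hp with hp | hp
      exacts [hP p hp, State.hi_lt_of_mem_critPairs hk' hG hp]
  | updateRet h => exact ⟨hi, hG, hP, trivial⟩

/-- Only `spolAccept` and `redUnsafe` generate S-polynomials, and both test the higher part against
the same rule lists to which the new rule is then added. -/
theorem Step.ruleInvariant {st st' : State n K} (hstep : Step ord st st') (hr : RefsBelow st)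
    (h : RuleInvariant st) : RuleInvariant st' := by
  cases hstep with
  | call _ j _ st'' hst' => subst hst'; exact h.congr rfl (fun _ => rfl) rfl rfl
  | spolAccept B F hph p hp hhi _ =>
    have hb := hr.phase_lt
    rw [hph] at hb
    exact (h.addSPoly (ord := ord) p.ulo p.lo (hb.1 p hp) hhi).congr rfl (fun _ => rfl) rfl rfl
  | redZero T D _ k => exact (h.setPoly k 0).congr rfl (fun _ => rfl) rfl rfl
  | redDone T D _ k _ _ q =>
    exact (h.setPoly k (monic ord q)).congr rfl (fun _ => rfl) rfl rfl
  | redSafe T D _ k _ _ q _ _ j _ u =>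
    exact (h.setPoly k (q - monomial u (ord.leadingCoeff q / ord.leadingCoeff (st.R j).poly) *
      (st.R j).poly)).congr rfl (fun _ => rfl) rfl rfl
  | redUnsafe T D hph k hk _ q _ _ j hj u hu _ =>
    have hb := hr.phase_lt
    rw [hph] at hb
    have hjN : j < (st.setPoly k q).N := by
      rcases Finset.mem_union.1 hj.1 with h' | h'
      exacts [hr.G_lt j h', hb.2 j h']
    -- The component taken from `hj` is condition (c), that the multiplied reductor is not
    -- rewritten.
    exact ((h.setPoly k q).addSPoly (ord := ord) 0 k hjN (hu ▸ hj.2.2.2.1)).congr rfl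
      (fun _ => rfl) rfl rfl
  | _ => exact h.congr rfl (fun _ => rfl) rfl rfl

/-- A step does not change signatures and origins of the cells in use. -/
theorem Step.persist {st st' : State n K} (hstep : Step ord st st') :
    st.N ≤ st'.N ∧ ∀ k < st.N, st'.sig k = st.sig k ∧ st'.origin k = st.origin k := by
  cases hstep with
  | call _ j _ st'' hst' => subst hst'; exact ⟨le_rfl, fun k _ => ⟨rfl, rfl⟩⟩
  | spolAccept B F _ p =>
    exact ⟨Nat.le_succ _, fun l hl => ⟨st.sig_addSPoly_of_ne p.uhi p.hi p.ulo p.lo hl.ne,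
      Function.update_of_ne hl.ne _ _⟩⟩
  | redZero T D _ k => exact ⟨le_rfl, fun l _ => ⟨st.sig_setPoly k _ l, rfl⟩⟩
  | redDone T D _ k _ _ q => exact ⟨le_rfl, fun l _ => ⟨st.sig_setPoly k _ l, rfl⟩⟩
  | redSafe T D _ k _ _ q _ _ j _ u => exact ⟨le_rfl, fun l _ => ⟨st.sig_setPoly k _ l, rfl⟩⟩
  | redUnsafe T D _ k _ _ q _ _ j _ u =>
    exact ⟨Nat.le_succ _, fun l hl => ⟨((st.setPoly k q).sig_addSPoly_of_ne u j 0 k hl.ne).trans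
      (st.sig_setPoly k q l), Function.update_of_ne hl.ne _ _⟩⟩
  | _ => exact ⟨le_rfl, fun k _ => ⟨rfl, rfl⟩⟩

/-! ### Finiteness along an execution -/

section
variable {f : Fin m → MvPolynomial (Fin n) K} {run : ℕ → State n K}

theorem IsRun.invariant (hm : 0 < m) (hrun : IsRun ord f run) (τ : ℕ) :
    RefsBelow (run τ) ∧ RuleInvariant (run τ) := by
  induction τ with
  | zero => rw [hrun.1]; exact ⟨refsBelow_initial hm f, ruleInvariant_initial f⟩
  | succ τ ih =>
    rcases hrun.2 τ with h | h
    · exact ⟨h.refsBelow ih.1, h.ruleInvariant ih.1 ih.2⟩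
    · rwa [h.2]

/-- This allows facts witnessed at different times to be compared in one later state. -/
theorem IsRun.persist (hrun : IsRun ord f run) {τ τ' : ℕ} (hτ : τ ≤ τ') :
    (run τ).N ≤ (run τ').N ∧ ∀ k < (run τ).N,
      (run τ').sig k = (run τ).sig k ∧ (run τ').origin k = (run τ).origin k := by
  induction τ', hτ using Nat.le_induction with
  | base => exact ⟨le_rfl, fun k _ => ⟨rfl, rfl⟩⟩
  | succ τ' _ ih =>
    rcases hrun.2 τ' with h | h
    · have hp := h.persist
      refine ⟨ih.1.trans hp.1, fun k hk => ?_⟩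
      have h1 := hp.2 k (hk.trans_le ih.1)
      have h2 := ih.2 k hk
      exact ⟨h1.1.trans h2.1, h1.2.trans h2.2⟩
    · rwa [h.2]

/-- A labeled polynomial is the higher part of finitely many S-polynomials. -/
theorem IsRun.finite_isHigherPart (hm : 0 < m) (hrun : IsRun ord f run) (L : ℕ) :
    {l : ℕ | IsHigherPart run L l}.Finite := by
  by_contra hinf
  replace hinf : {l : ℕ | IsHigherPart run L l}.Infinite := hinf
  -- Increasing enumeration by position is enumeration in order of generation.
  have hmono : StrictMono (Nat.nth (IsHigherPart run L)) := Nat.nth_strictMono hinf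
  have he : ∀ k, IsHigherPart run L (Nat.nth (IsHigherPart run L) k) :=
    Nat.nth_mem_of_infinite hinf
  generalize Nat.nth (IsHigherPart run L) = e at hmono he
  choose τ c hτ using he
  -- Dickson's lemma: some earlier signature monomial divides a later one.
  obtain ⟨a, b, hab, hle⟩ := wellQuasiOrdered_le fun k => ((run (τ k)).sig (e k)).mon
  have ha := (hrun.invariant hm (τ a)).2.origin_lt (hτ a)
  have hb := (hrun.invariant hm (τ b)).2.origin_lt (hτ b)
  have ha' := (hrun.persist (le_max_left (τ a) (τ b))).2 _ ha.2
  have hb' := (hrun.persist (le_max_right (τ a) (τ b))).2 _ hb.2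
  -- At time `max (τ a) (τ b)` both S-polynomials are present with unchanged signatures and origins,
  -- so the invariant of that single state excludes the divisibility.
  refine (hrun.invariant hm (max (τ a) (τ b))).2.not_le (ha'.2.trans (hτ a))
    (hb'.2.trans (hτ b)) (hmono hab) ?_
  rwa [ha'.1, hb'.1]

end

/-- The S-pair-chains of length two that start at `L` are determined by their second element,
an S-polynomial with higher part `L`. -/
theorem finite_isSPairChain_two {run : ℕ → State n K} {L : ℕ}
    (h : {l : ℕ | IsHigherPart run L l}.Finite) :
    {c : List ℕ | IsSPairChain run c ∧ c.length = 2 ∧ c.head? = some L}.Finite := by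
  refine (h.image fun l => [L, l]).subset ?_
  rintro c ⟨hc, hlen, hhead⟩
  obtain ⟨a, b, rfl⟩ := List.length_eq_two.1 hlen
  obtain rfl : a = L := by simpa using hhead
  have h2 := hc.2
  rw [List.isChain_pair] at h2
  exact ⟨b, h2.1, rfl⟩

end F5

theorem mainTheorem8 {n m : ℕ} {K : Type*} [Field K] (ord : MonomialOrder (Fin n))
    (hm : 0 < m) (f : Fin m → MvPolynomial (Fin n) K)
    (hf : ∀ i, f i ≠ 0) (hhom : ∀ i, ∃ d, (f i).IsHomogeneous d)
    (run : ℕ → F5.State n K) (hrun : F5.IsRun ord f run)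
    (L : ℕ) (hL : F5.Generated run L) :
    {l : ℕ | F5.IsHigherPart run L l}.Finite ∧
      {c : List ℕ | F5.IsSPairChain run c ∧ c.length = 2 ∧ c.head? = some L}.Finite :=
  have h := hrun.finite_isHigherPart hm L
  ⟨h, F5.finite_isSPairChain_two h⟩
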